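/- A one-state Turing machine consists of a finite tape alphabet $\Gamma$ containing a blank symbol $\sqcup$, an input alphabet $\Sigma\subseteq\Gamma\setminus\{\sqcup\}$, a set $H\subseteq\Gamma$ of halting symbols, and a transition function $\delta:\Gamma\setminus H\to\Gamma\times\{L,R\}$. It works on a two-way infinite tape. At the start, the input is written on consecutive cells, all other cells are blank, and the head is on the leftmost symbol of the input (on a blank cell if the input is empty). If the symbol $a$ under the head is in $H$, the machine halts; otherwise, with $\delta(a)=(b,D)$, it replaces $a$ by $b$ and moves the head one cell in direction $D$ ($L$ = left, $R$ = right). The language recognized by the machine is the set of words $x\in\Sigma^*$ on which it halts. Let $M_{cc}$ be the one-state Turing machine with $\Sigma=\{u,0,h\}$, the nine-symbol tape alphabet $\Gamma=\{\sqcup,u,U,h,0,1,Z,C,B\}$, $H=\{h\}$, and $$\delta(u)=(U,R),\quad \delta(0)=(1,L),\quad \delta(U)=(C,R),\quad \delta(1)=(Z,R),$$ $$\delta(Z)=(0,L),\quad \delta(C)=(B,L),\quad \delta(B)=(C,R),\quad \delta(\sqcup)=(\sqcup,L).$$ **Theorem.** The language $L_{cc}=\{x\in\Sigma^* \mid M_{cc}\text{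 halts on input }x\}$ is not context-free. -/

import Mathlib

/-- A one-state Turing machine with input alphabet `I` and (finite) tape alphabet `A`; the blank
symbol is `default : A`. The input alphabet is embedded in the tape alphabet and does not contain
the blank. There is a set of halting symbols, and the transition function gives, for each
non-halting symbol under the head, the symbol to write and the direction of the move. -/
structure OneStateTM (I A : Type) [Inhabited A] [Finite A] where
  /-- The inclusion of the input alphabet in the tape alphabet. -/
  incl : I ↪ A
  /-- The blank is not an input symbol. -/
  incl_ne_blank : ∀ i, incl i ≠ default
  /-- The halting symbols. -/
  halting : Set A
  /-- The transition function. -/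
  δ : {a : A // a ∉ halting} → A × Turing.Dir

namespace OneStateTM

variable {I A : Type} [Inhabited A] [Finite A]

/-- The initial tape: the head is on the leftmost symbol of the input, and all the cells outside
the input are blank. -/
def init (M : OneStateTM I A) (x : List I) : Turing.Tape A :=
  Turing.Tape.mk₁ (x.map M.incl)

/-- One step: the symbol under the head is not halting; it is replaced, and then the head moves. -/
def Step (M : OneStateTM I A) (s t : Turing.Tape A) : Prop :=
  ∃ hs : s.head ∉ M.halting,
    t = (s.write (M.δ ⟨s.head, hs⟩).1).move (M.δ ⟨s.head, hs⟩).2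

/-- `M` halts on `x`: after finitely many steps from the initial tape, the symbol under the head
is a halting symbol. -/
def HaltsOn (M : OneStateTM I A) (x : List I) : Prop :=
  ∃ t : Turing.Tape A, Relation.ReflTransGen M.Step (M.init x) t ∧ t.head ∈ M.halting

/-- The language recognized by `M`: the set of all inputs on which `M` halts. -/
def language (M : OneStateTM I A) : Language I :=
  {x | M.HaltsOn x}

end OneStateTM

/-- The input alphabet `{u, 0, h}`. -/
inductive CCInput : Type
  | u | zero | h

/-- The tape alphabet `{⊔, u, U, h, 0, 1, Z, C, B}`. -/
inductive CCTape : Type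
  | blank | u | U | h | zero | one | Z | C | B

instance : Inhabited CCTape := ⟨CCTape.blank⟩

instance : Finite CCTape :=
  Finite.of_surjective
    (![.blank, .u, .U, .h, .zero, .one, .Z, .C, .B] : Fin 9 → CCTape) <| by
      intro a
      cases a
      exacts [⟨0, rfl⟩, ⟨1, rfl⟩, ⟨2, rfl⟩, ⟨3, rfl⟩, ⟨4, rfl⟩, ⟨5, rfl⟩, ⟨6, rfl⟩, ⟨7, rfl⟩,
        ⟨8, rfl⟩]

/-- The inclusion `{u, 0, h} ⊆ {⊔, u, U, h, 0, 1, Z, C, B}`. -/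
def CCInput.toTape : CCInput → CCTape
  | .u => .u
  | .zero => .zero
  | .h => .h

/-- The one-state machine `M_cc`, whose only halting symbol is `h`. -/
def Mcc : OneStateTM CCInput CCTape where
  incl := ⟨CCInput.toTape, by intro a b hab; cases a <;> cases b <;> first | rfl | cases hab⟩
  incl_ne_blank := by intro i hi; cases i <;> cases hi
  halting := {CCTape.h}
  δ
    | ⟨.u, _⟩ => (.U, .right)
    | ⟨.zero, _⟩ => (.one, .left)
    | ⟨.U, _⟩ => (.C, .right)
    | ⟨.one, _⟩ => (.Z, .right)
    | ⟨.Z, _⟩ => (.zero, .left)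
    | ⟨.C, _⟩ => (.B, .left)
    | ⟨.B, _⟩ => (.C, .right)
    | ⟨.blank, _⟩ => (.blank, .left)
    | ⟨.h, hh⟩ => absurd rfl hh

/-! On `u^n 0^m h` the zeros act as an `m`-digit binary counter, lowest digit first. Each increment
sends the head left to fetch one `U`. An overflow carries the head right onto `h`; if the `U`s run
out first, it drifts left over blanks forever. Hence the machine halts iff `2 ^ m ≤ n + 1`
(`Mcc.mem_language_iff`). No context-free language can match this exponential threshold. The pumping
lemma `exists_pumping` also remembers which letters occur in a subtree's yield, so pumping keeps
words sorted; this replaces intersection with the regular language `u*0*h`. At `n = 2 ^ p - 1`, `m =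
p`, pumping down loses a needed `u`, or pumping up adds a zero without doubling `n + 1`. -/

namespace ContextFreeGrammar

/-! ### Parse forests and pumping with labels -/

variable {T κ : Type*}

/-- `g.LabelledDerives φ Λ n s w`: there is a parse forest with roots `s`, yield `w` and `n` inner
nodes, such that each inner node with nonterminal `A` and yield `x` has its label `(A, φ x)`
in `Λ`. -/
inductive LabelledDerives (g : ContextFreeGrammar T) (φ : List T → κ) (Λ : Set (g.NT × κ)) :
    ℕ → List (Symbol T g.NT) → List T → Prop
  | nil : LabelledDerives g φ Λ 0 [] []
  | terminal {n s w} (a : T) : LabelledDerives g φ Λ n s w →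
      LabelledDerives g φ Λ n (.terminal a :: s) (a :: w)
  | nonterminal {m n s x w} {r : ContextFreeRule T g.NT} (hr : r ∈ g.rules)
      (hΛ : (r.input, φ x) ∈ Λ) : LabelledDerives g φ Λ m r.output x →
      LabelledDerives g φ Λ n s w →
      LabelledDerives g φ Λ (m + n + 1) (.nonterminal r.input :: s) (x ++ w)

namespace LabelledDerives

variable {g : ContextFreeGrammar T} {φ : List T → κ} {Λ Λ' : Set (g.NT × κ)}

/-- Only left sides of rules matter, so `Set.univ` can be shrunk to a finite label set even if
`g.NT` is infinite. -/
lemma mono (h : ∀ r ∈ g.rules, ∀ x, (r.input, φ x) ∈ Λ → (r.input, φ x) ∈ Λ') {n : ℕ}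
    {s : List (Symbol T g.NT)} {w : List T} (hD : g.LabelledDerives φ Λ n s w) :
    g.LabelledDerives φ Λ' n s w := by
  induction hD with
  | nil => exact nil
  | terminal a _ ih => exact terminal a ih
  | nonterminal hr hΛ _ _ ih₁ ih₂ => exact nonterminal hr (h _ hr _ hΛ) ih₁ ih₂

lemma derives {n : ℕ} {s : List (Symbol T g.NT)} {w : List T}
    (hD : g.LabelledDerives φ Λ n s w) : g.Derives s (w.map .terminal) := by
  induction hD with
  | nil => exact .refl _
  | terminal a _ ih => exact ih.append_left [.terminal a]
  | @nonterminal m n s x w r hr hΛ _ _ ih₁ ih₂ =>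
    have h : g.Produces (.nonterminal r.input :: s) (r.output ++ s) :=
      ⟨r, hr, .head s⟩
    rw [List.map_append]
    exact h.trans_derives ((ih₁.append_right s).trans (ih₂.append_left _))

lemma append {m n : ℕ} {s t : List (Symbol T g.NT)} {v w : List T}
    (hs : g.LabelledDerives φ Λ m s v) (ht : g.LabelledDerives φ Λ n t w) :
    g.LabelledDerives φ Λ (m + n) (s ++ t) (v ++ w) := by
  induction hs with
  | nil => simpa using ht
  | terminal a _ ih => exact terminal a ih
  | @nonterminal m' n' s x w' r hr hΛ h₁ _ _ ih =>
    have := nonterminal hr hΛ h₁ ih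
    rw [List.append_assoc, List.cons_append]
    convert this using 1
    omega

lemma exists_of_append {n : ℕ} {s t : List (Symbol T g.NT)} {w : List T}
    (h : g.LabelledDerives φ Λ n (s ++ t) w) :
    ∃ n₁ n₂ w₁ w₂, w = w₁ ++ w₂ ∧ g.LabelledDerives φ Λ n₁ s w₁ ∧
      g.LabelledDerives φ Λ n₂ t w₂ := by
  induction s generalizing n w with
  | nil => exact ⟨0, n, [], w, rfl, nil, h⟩
  | cons a s ih =>
    cases h with
    | terminal a h =>
      obtain ⟨n₁, n₂, w₁, w₂, rfl, h₁, h₂⟩ := ih h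
      exact ⟨n₁, n₂, a :: w₁, w₂, rfl, terminal a h₁, h₂⟩
    | nonterminal hr hΛ h₀ h =>
      obtain ⟨n₁, n₂, w₁, w₂, rfl, h₁, h₂⟩ := ih h
      exact ⟨_, n₂, _, w₂, (List.append_assoc _ _ _).symm, nonterminal hr hΛ h₀ h₁, h₂⟩

lemma map_terminal (w : List T) :
    g.LabelledDerives φ Λ 0 (w.map .terminal) w := by
  induction w with
  | nil => exact nil
  | cons a w ih => exact terminal a ih

lemma of_derives (φ : List T → κ) {s : List (Symbol T g.NT)} {w : List T}
    (h : g.Derives s (w.map .terminal)) : ∃ n, g.LabelledDerives φ Set.univ n s w := by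
  induction h using Relation.ReflTransGen.head_induction_on with
  | refl => exact ⟨0, map_terminal w⟩
  | head h _ ih =>
    obtain ⟨n, hn⟩ := ih
    obtain ⟨r, hr, hst⟩ := h
    obtain ⟨p, q, rfl, rfl⟩ := hst.exists_parts
    rw [List.append_assoc] at hn ⊢
    obtain ⟨n₁, n₂, w₁, w₂, rfl, h₁, h₂⟩ := hn.exists_of_append
    obtain ⟨n₃, n₄, w₃, w₄, rfl, h₃, h₄⟩ := h₂.exists_of_append
    exact ⟨_, h₁.append (nonterminal hr (Set.mem_univ _) h₃ h₄)⟩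

/-- Either the label `l` does not occur in a parse forest, or the forest has a subtree with
label `l`, which may be replaced by any tree with the same root. -/
lemma avoid_or_exists_subtree (l : g.NT × κ) {n : ℕ} {s : List (Symbol T g.NT)} {w : List T}
    (h : g.LabelledDerives φ Λ n s w) :
    g.LabelledDerives φ (Λ \ {l}) n s w ∨
      ∃ c k α x β, n = c + k ∧ w = α ++ x ++ β ∧ φ x = l.2 ∧
        g.LabelledDerives φ Set.univ k [.nonterminal l.1] x ∧
        ∀ k' x', g.LabelledDerives φ Set.univ k' [.nonterminal l.1] x' →
          g.LabelledDerives φ Set.univ (c + k') s (α ++ x' ++ β) := by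
  induction h with
  | nil => exact .inl nil
  | terminal a _ ih =>
    rcases ih with ih | ⟨c, k, α, x, β, rfl, rfl, hx, hk, ih⟩
    · exact .inl (terminal a ih)
    · exact .inr ⟨c, k, a :: α, x, β, rfl, rfl, hx, hk, fun k' x' h => terminal a (ih k' x' h)⟩
  | @nonterminal m n s x w r hr hΛ h₁ h₂ ih₁ ih₂ =>
    have u₁ : g.LabelledDerives φ Set.univ m r.output x := h₁.mono fun _ _ _ _ => Set.mem_univ _
    have u₂ : g.LabelledDerives φ Set.univ n s w := h₂.mono fun _ _ _ _ => Set.mem_univ _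
    by_cases hl : (r.input, φ x) = l
    · subst hl
      refine .inr ⟨n, m + 1, [], x, w, by omega, rfl, rfl, ?_, fun k' x' h => ?_⟩
      · simpa using nonterminal hr (Set.mem_univ _) u₁ nil
      · rw [Nat.add_comm]
        exact h.append u₂
    · rcases ih₁ with ih₁ | ⟨c, k, α, y, β, rfl, rfl, hy, hk, ih₁⟩
      · rcases ih₂ with ih₂ | ⟨c, k, α, y, β, rfl, rfl, hy, hk, ih₂⟩
        · exact .inl (nonterminal hr ⟨hΛ, hl⟩ ih₁ ih₂)
        · refine .inr ⟨m + c + 1, k, x ++ α, y, β, by omega, by simp, hy, hk,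
            fun k' y' h => ?_⟩
          have := nonterminal hr (Set.mem_univ _) u₁ (ih₂ k' y' h)
          simp only [List.append_assoc] at this ⊢
          convert this using 1
          omega
      · refine .inr ⟨c + n + 1, k, α, y, β ++ w, by omega, by simp, hy, hk,
          fun k' y' h => ?_⟩
        have := nonterminal hr (Set.mem_univ _) (ih₁ k' y' h) u₂
        simp only [List.append_assoc] at this ⊢
        convert this using 1
        omega

end LabelledDerives

/-- A parse forest with roots `s`, yield `w` and `n` inner nodes contains two nested subtrees with
the same label, with yields `v ++ x ++ y` and `x`. -/
def HasRepetition (g : ContextFreeGrammar T) (φ : List T → κ) (n : ℕ) (s : List (Symbol T g.NT))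
    (w : List T) : Prop :=
  ∃ (A : g.NT) (c d k : ℕ) (α v x y β : List T), n = c + (d + 1 + k) ∧
    w = α ++ (v ++ x ++ y) ++ β ∧ φ x = φ (v ++ x ++ y) ∧
    g.LabelledDerives φ Set.univ k [.nonterminal A] x ∧
    (∀ k' x', g.LabelledDerives φ Set.univ k' [.nonterminal A] x' →
      g.LabelledDerives φ Set.univ (d + 1 + k') [.nonterminal A] (v ++ x' ++ y)) ∧
    ∀ k' x', g.LabelledDerives φ Set.univ k' [.nonterminal A] x' →
      g.LabelledDerives φ Set.univ (c + k') s (α ++ x' ++ β)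

/-- Below a root, either its label recurs, giving the nested pair, or that label can be deleted from
`Λ`, and induction on the number of labels applies. Each level multiplies the length by at most `b`;
the base `b + 1` keeps the bound positive for terminal roots. -/
lemma LabelledDerives.length_le_or_hasRepetition {g : ContextFreeGrammar T} {φ : List T → κ}
    {b : ℕ} (hb : ∀ r ∈ g.rules, r.output.length ≤ b) {j : ℕ} {Λ : Set (g.NT × κ)}
    (hfin : Λ.Finite) (hj : Λ.ncard ≤ j) {n : ℕ} {s : List (Symbol T g.NT)} {w : List T}
    (h : g.LabelledDerives φ Λ n s w) :
    w.length ≤ s.length * (b + 1) ^ j ∨ g.HasRepetition φ n s w := by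
  induction j generalizing Λ n s w with
  | zero =>
    left
    have hΛ : Λ = ∅ := (Set.ncard_eq_zero hfin).1 (Nat.le_zero.1 hj)
    subst hΛ
    induction h with
    | nil => simp
    | terminal a _ ih => simp_all
    | nonterminal _ hΛ => exact hΛ.elim
  | succ j ihj =>
    induction h with
    | nil => simp
    | terminal a _ ih =>
      rcases ih with ih | ⟨A, c, d, k, α, v, x, y, β, rfl, rfl, hx, h₁, h₂, h₃⟩
      · left
        have := Nat.one_le_pow (j + 1) (b + 1) (by omega)
        simp only [List.length_cons, Nat.add_mul]
        omega
      · exact .inr ⟨A, c, d, k, a :: α, v, x, y, β, rfl, rfl, hx, h₁, h₂,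
          fun k' x' h => terminal a (h₃ k' x' h)⟩
    | @nonterminal m n s x w r hr hΛ h₁ h₂ _ ih₂ =>
      have u₁ : g.LabelledDerives φ Set.univ m r.output x := h₁.mono fun _ _ _ _ => Set.mem_univ _
      have u₂ : g.LabelledDerives φ Set.univ n s w := h₂.mono fun _ _ _ _ => Set.mem_univ _
      rcases ih₂ with ih₂ | ⟨A, c, d, k, α, v, z, y, β, rfl, rfl, hz, e₁, e₂, e₃⟩
      · rcases h₁.avoid_or_exists_subtree (r.input, φ x) with h |
          ⟨c, k, α, y, β, rfl, rfl, hy, hk, h⟩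
        · have hcard : (Λ \ {(r.input, φ x)}).ncard ≤ j := by
            rw [Set.ncard_sdiff_singleton_of_mem hΛ]
            omega
          rcases ihj (hfin.subset Set.sdiff_subset) hcard h with
            hlen | ⟨A, c, d, k, α, v, z, y, β, rfl, rfl, hz, e₁, e₂, e₃⟩
          · left
            have h₃ : r.output.length * (b + 1) ^ j ≤ (b + 1) ^ (j + 1) := by
              rw [pow_succ, Nat.mul_comm]
              exact Nat.mul_le_mul_left _ ((hb r hr).trans (Nat.le_succ b))
            simp only [List.length_cons, List.length_append, Nat.add_mul]
            omega
          · refine .inr ⟨A, c + n + 1, d, k, α, v, z, y, β ++ w, by omega, by simp, hz, e₁, e₂,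
              fun k' x' h => ?_⟩
            have := nonterminal hr (Set.mem_univ _) (e₃ k' x' h) u₂
            simp only [List.append_assoc] at this ⊢
            convert this using 1
            omega
        -- The root is the outer node of the pair, and the subtree found below it the inner one.
        · refine .inr ⟨r.input, n, c, k, [], α, y, β, w, by omega, by simp, hy, hk,
            fun k' x' h' => ?_, fun k' x' h' => ?_⟩
          · have := nonterminal hr (Set.mem_univ _) (h k' x' h') nil
            simp only [List.append_nil] at this
            convert this using 1
            omega
          · rw [Nat.add_comm]
            exact h'.append u₂
      · refine .inr ⟨A, m + c + 1, d, k, x ++ α, v, z, y, β, by omega, by simp, hz, e₁, e₂,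
          fun k' x' h => ?_⟩
        have := nonterminal hr (Set.mem_univ _) u₁ (e₃ k' x' h)
        simp only [List.append_assoc] at this ⊢
        convert this using 1
        omega

end ContextFreeGrammar

/-- A pumping lemma in which, for a given function `φ` with finitely many values, the pumped part
`v ++ x ++ y` and its middle `x` have the same value under `φ`. -/
theorem Language.IsContextFree.exists_pumping {T : Type*} {κ : Type*} [Finite κ]
    (φ : List T → κ) {L : Language T} (hL : L.IsContextFree) :
    ∃ p : ℕ, ∀ w ∈ L, p < w.length → ∃ α v x y β : List T,
      w = α ++ (v ++ x ++ y) ++ β ∧ v ++ y ≠ [] ∧ φ x = φ (v ++ x ++ y) ∧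
      ∀ i : ℕ, α ++ ((List.replicate i v).flatten ++ x ++ (List.replicate i y).flatten) ++ β ∈ L := by
  classical
  obtain ⟨g, rfl⟩ := hL
  let Λ : Set (g.NT × κ) :=
    (ContextFreeRule.input '' (g.rules : Set (ContextFreeRule T g.NT))) ×ˢ Set.univ
  have hfin : Λ.Finite := (g.rules.finite_toSet.image _).prod Set.finite_univ
  let b := g.rules.sup (·.output.length)
  refine ⟨(b + 1) ^ Λ.ncard, fun w hw hlen => ?_⟩
  have hex : ∃ n, g.LabelledDerives φ Set.univ n [.nonterminal g.initial] w :=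
    ContextFreeGrammar.LabelledDerives.of_derives φ hw
  -- A parse tree with the fewest inner nodes.
  have hD := Nat.find_spec hex
  have hΛ : g.LabelledDerives φ Λ (Nat.find hex) [.nonterminal g.initial] w :=
    hD.mono fun r hr x _ => Set.mk_mem_prod (Set.mem_image_of_mem _ hr) (Set.mem_univ _)
  rcases hΛ.length_le_or_hasRepetition (fun r hr => Finset.le_sup (f := (·.output.length)) hr)
      hfin le_rfl with h | ⟨A, c, d, k, α, v, x, y, β, hn, rfl, hx, h₁, h₂, h₃⟩
  · simp only [List.length_singleton, one_mul] at h
    exact absurd h (Nat.not_le.2 hlen)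
  refine ⟨α, v, x, y, β, rfl, fun hvy => ?_, hx, fun i => ?_⟩
  · obtain ⟨rfl, rfl⟩ := List.append_eq_nil_iff.1 hvy
    -- With `v` and `y` empty, putting the inner subtree in place of the outer one saves `d + 1`
    -- nodes, against minimality.
    have hle := Nat.find_min' hex (m := c + k) (by simpa using h₃ k x h₁)
    omega
  · suffices h : ∃ k', g.LabelledDerives φ Set.univ k' [.nonterminal A]
        ((List.replicate i v).flatten ++ x ++ (List.replicate i y).flatten) by
      obtain ⟨k', hk'⟩ := h
      exact (h₃ k' _ hk').derives
    induction i with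
    | zero => exact ⟨k, by simpa using h₁⟩
    | succ i ih =>
      obtain ⟨k', hk'⟩ := ih
      refine ⟨d + 1 + k', ?_⟩
      rw [List.replicate_succ, List.replicate_succ', List.flatten_cons, List.flatten_append]
      simpa only [List.append_assoc, List.flatten_singleton] using h₂ k' _ hk'

/-! ### Runs of one-state machines -/

namespace OneStateTM

variable {I A : Type} [Inhabited A] [Finite A]

/-- `M` halts when started with the reversed word `l` to the left of the head and the word `r`
to the right, the head being on the first symbol of `r`. -/
def HaltsFrom (M : OneStateTM I A) (l r : List A) : Prop :=
  ∃ t, Relation.ReflTransGen M.Step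
    (Turing.Tape.mk' (Turing.ListBlank.mk l) (Turing.ListBlank.mk r)) t ∧ t.head ∈ M.halting

variable {M : OneStateTM I A} {l r : List A} {a b : A}

lemma haltsOn_iff {x : List I} : M.HaltsOn x ↔ M.HaltsFrom [] (x.map M.incl) := Iff.rfl

lemma haltsFrom_of_mem (ha : a ∈ M.halting) : M.HaltsFrom l (a :: r) :=
  ⟨_, .refl, by simpa using ha⟩

lemma haltsFrom_iff_of_step {l' r' : List A} (ha : a ∉ M.halting)
    (h : Turing.Tape.mk' (Turing.ListBlank.mk l') (Turing.ListBlank.mk r') =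
      ((Turing.Tape.mk' (Turing.ListBlank.mk l) (Turing.ListBlank.mk (a :: r))).write
        (M.δ ⟨a, ha⟩).1).move (M.δ ⟨a, ha⟩).2) :
    M.HaltsFrom l (a :: r) ↔ M.HaltsFrom l' r' := by
  constructor
  · rintro ⟨t, ht, hh⟩
    rcases Relation.ReflTransGen.cases_head ht with rfl | ⟨c, ⟨hs, rfl⟩, hc⟩
    · exact absurd (by simpa using hh) ha
    · refine ⟨t, ?_, hh⟩
      rw [h]
      simpa using hc
  · rintro ⟨t, ht, hh⟩
    refine ⟨t, .head ⟨by simpa using ha, ?_⟩ ht, hh⟩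
    simpa using h

lemma haltsFrom_iff_right (ha : a ∉ M.halting) (h : M.δ ⟨a, ha⟩ = (b, .right)) :
    M.HaltsFrom l (a :: r) ↔ M.HaltsFrom (b :: l) r := by
  apply haltsFrom_iff_of_step ha
  rw [h, ← Turing.ListBlank.cons_mk, Turing.Tape.write_mk', Turing.Tape.move_right_mk']
  simp

lemma haltsFrom_iff_left (ha : a ∉ M.halting) (h : M.δ ⟨a, ha⟩ = (b, .left)) :
    M.HaltsFrom l (a :: r) ↔ M.HaltsFrom l.tail (l.headI :: b :: r) := by
  apply haltsFrom_iff_of_step ha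
  rw [h, ← Turing.ListBlank.cons_mk, Turing.Tape.write_mk', Turing.Tape.move_left_mk']
  cases l <;> simp

/-- If the machine keeps the blank and moves left on it, it never halts once it is on a blank
with only blanks to the left. -/
lemma not_haltsFrom_default (ha : default ∉ M.halting) (h : M.δ ⟨default, ha⟩ = (default, .left)) :
    ¬ M.HaltsFrom [] (default :: r) := by
  rintro ⟨t, ht, hh⟩
  suffices H : ∃ r, t =
      Turing.Tape.mk' (Turing.ListBlank.mk []) (Turing.ListBlank.mk (default :: r)) by
    obtain ⟨r, rfl⟩ := H
    exact ha (by simpa using hh)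
  clear hh
  induction ht with
  | refl => exact ⟨r, rfl⟩
  | tail _ hs ih =>
    obtain ⟨r, rfl⟩ := ih
    obtain ⟨hs, rfl⟩ := hs
    refine ⟨default :: r, ?_⟩
    have h' : M.δ ⟨_, hs⟩ = (default, .left) := by simpa using h
    rw [h', ← Turing.ListBlank.cons_mk, Turing.Tape.write_mk', Turing.Tape.move_left_mk']
    simp

end OneStateTM

/-! ### The binary counter of `Mcc` -/

namespace Mcc

open OneStateTM CCTape

lemma not_mem_halting {a : CCTape} (h : a ≠ CCTape.h) : a ∉ Mcc.halting := h

variable {l r : List CCTape}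

lemma haltsFrom_h : Mcc.HaltsFrom l (h :: r) := haltsFrom_of_mem rfl

lemma not_haltsFrom_blank : ¬ Mcc.HaltsFrom [] (blank :: r) :=
  not_haltsFrom_default (not_mem_halting (by rintro ⟨⟩)) rfl

lemma haltsFrom_u : Mcc.HaltsFrom l (u :: r) ↔ Mcc.HaltsFrom (U :: l) r :=
  haltsFrom_iff_right (not_mem_halting (by rintro ⟨⟩)) rfl

lemma haltsFrom_U : Mcc.HaltsFrom l (U :: r) ↔ Mcc.HaltsFrom (C :: l) r :=
  haltsFrom_iff_right (not_mem_halting (by rintro ⟨⟩)) rfl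

lemma haltsFrom_one : Mcc.HaltsFrom l (one :: r) ↔ Mcc.HaltsFrom (Z :: l) r :=
  haltsFrom_iff_right (not_mem_halting (by rintro ⟨⟩)) rfl

lemma haltsFrom_B : Mcc.HaltsFrom l (B :: r) ↔ Mcc.HaltsFrom (C :: l) r :=
  haltsFrom_iff_right (not_mem_halting (by rintro ⟨⟩)) rfl

lemma haltsFrom_zero :
    Mcc.HaltsFrom l (zero :: r) ↔ Mcc.HaltsFrom l.tail (l.headI :: one :: r) :=
  haltsFrom_iff_left (not_mem_halting (by rintro ⟨⟩)) rfl

lemma haltsFrom_Z : Mcc.HaltsFrom l (Z :: r) ↔ Mcc.HaltsFrom l.tail (l.headI :: zero :: r) :=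
  haltsFrom_iff_left (not_mem_halting (by rintro ⟨⟩)) rfl

lemma haltsFrom_C : Mcc.HaltsFrom l (C :: r) ↔ Mcc.HaltsFrom l.tail (l.headI :: B :: r) :=
  haltsFrom_iff_left (not_mem_halting (by rintro ⟨⟩)) rfl

lemma haltsFrom_replicate_u (n : ℕ) :
    Mcc.HaltsFrom l (List.replicate n u ++ r) ↔ Mcc.HaltsFrom (List.replicate n U ++ l) r := by
  induction n generalizing l with
  | zero => rfl
  | succ n ih =>
    rw [List.replicate_succ, List.cons_append, haltsFrom_u, ih, List.replicate_succ',
      List.append_assoc, List.singleton_append]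

lemma haltsFrom_replicate_B (n : ℕ) :
    Mcc.HaltsFrom l (List.replicate n B ++ r) ↔ Mcc.HaltsFrom (List.replicate n C ++ l) r := by
  induction n generalizing l with
  | zero => rfl
  | succ n ih =>
    rw [List.replicate_succ, List.cons_append, haltsFrom_B, ih, List.replicate_succ',
      List.append_assoc, List.singleton_append]

/-- A head that leaves a block to the left passes all the symbols `C`. -/
lemma haltsFrom_left_replicate_C (n : ℕ) :
    Mcc.HaltsFrom (List.replicate n C ++ l).tail ((List.replicate n C ++ l).headI :: r) ↔
      Mcc.HaltsFrom l.tail (l.headI :: (List.replicate n B ++ r)) := by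
  induction n generalizing r with
  | zero => rfl
  | succ n ih =>
    rw [List.replicate_succ, List.cons_append, List.tail_cons, List.headI_cons, haltsFrom_C, ih,
      List.replicate_succ', List.append_assoc, List.singleton_append]

/-- The `m` lowest binary digits of `v`, lowest first. -/
def bits : ℕ → ℕ → List CCTape
  | 0, _ => []
  | m + 1, v => (if v % 2 = 1 then one else zero) :: bits m (v / 2)

lemma bits_zero (m : ℕ) : bits m 0 = List.replicate m zero := by
  induction m with
  | zero => rfl
  | succ m ih => simp [bits, ih, List.replicate_succ]

/-- All digits are 1, so the carry moves the head right through the whole counter. -/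
lemma haltsFrom_bits {m v : ℕ} (hv : v + 1 = 2 ^ m) :
    Mcc.HaltsFrom l (bits m v ++ h :: r) := by
  induction m generalizing v l with
  | zero => exact haltsFrom_h
  | succ m ih =>
    rw [pow_succ] at hv
    have h₁ : v % 2 = 1 := by omega
    rw [bits, if_pos h₁, List.cons_append, haltsFrom_one]
    exact ih (by omega)

/-- Unless the counter overflows, the head leaves it to the left after incrementing it. -/
lemma haltsFrom_bits_iff {m v : ℕ} (hv : v + 1 < 2 ^ m) :
    Mcc.HaltsFrom l (bits m v ++ r) ↔ Mcc.HaltsFrom l.tail (l.headI :: (bits m (v + 1) ++ r)) := by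
  induction m generalizing v l with
  | zero => simp at hv
  | succ m ih =>
    rw [pow_succ] at hv
    by_cases h₁ : v % 2 = 1
    -- The carry leaves `Z` on this digit; the head, returning from the higher digits, turns it into
    -- `zero`.
    · have h₂ : ¬ (v + 1) % 2 = 1 := by omega
      have h₃ : (v + 1) / 2 = v / 2 + 1 := by omega
      rw [bits, bits, if_pos h₁, if_neg h₂, h₃, List.cons_append, haltsFrom_one, ih (by omega),
        List.tail_cons, List.headI_cons, haltsFrom_Z, List.cons_append]
    · have h₂ : (v + 1) % 2 = 1 := by omega
      have h₃ : (v + 1) / 2 = v / 2 := by omega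
      rw [bits, bits, if_neg h₁, if_pos h₂, h₃, List.cons_append, haltsFrom_zero, List.cons_append]

/-- Each round raises `v` by one and turns one `U` into `C`, so `v + n` is invariant. -/
lemma haltsFrom_counter_iff {m v : ℕ} (k n : ℕ) (hv : v < 2 ^ m) :
    Mcc.HaltsFrom (List.replicate k C ++ List.replicate n U) (bits m v ++ [h]) ↔
      2 ^ m ≤ v + n + 1 := by
  induction n generalizing k v with
  | zero =>
    rcases Nat.lt_or_ge (v + 1) (2 ^ m) with hlt | hge
    · rw [haltsFrom_bits_iff hlt, haltsFrom_left_replicate_C]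
      -- No `U` is left: beyond the `C`s the head meets the blank, the default value of `headI`.
      exact iff_of_false not_haltsFrom_blank (by omega)
    · exact iff_of_true (haltsFrom_bits (by omega)) (by omega)
  | succ n ih =>
    rcases Nat.lt_or_ge (v + 1) (2 ^ m) with hlt | hge
    · rw [haltsFrom_bits_iff hlt, haltsFrom_left_replicate_C, List.replicate_succ, List.tail_cons,
        List.headI_cons, haltsFrom_U, haltsFrom_replicate_B, ← List.singleton_append,
        ← List.append_assoc, ← List.replicate_succ', ih _ hlt]
      omega
    · exact iff_of_true (haltsFrom_bits (by omega)) (by omega)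

theorem mem_language_iff (n m : ℕ) :
    List.replicate n .u ++ (List.replicate m .zero ++ [.h]) ∈ Mcc.language ↔ 2 ^ m ≤ n + 1 := by
  have h := haltsFrom_counter_iff (m := m) (v := 0) 0 n (by positivity)
  rw [bits_zero, Nat.zero_add] at h
  rw [← h]
  change Mcc.HaltsOn _ ↔ _
  rw [haltsOn_iff, List.map_append, List.map_append, List.map_replicate, List.map_replicate]
  have hu := haltsFrom_replicate_u (l := []) (r := List.replicate m zero ++ [CCTape.h]) n
  rw [List.append_nil] at hu
  exact hu

end Mcc

/-! ### Sorted words and the contradiction -/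

instance : DecidableEq CCInput
  | .u, .u | .zero, .zero | .h, .h => isTrue rfl
  | .u, .zero | .u, .h | .zero, .u | .zero, .h | .h, .u | .h, .zero => isFalse nofun

instance : Finite CCInput := Finite.of_injective _ Mcc.incl.injective

/-- The order `u < 0 < h` on the input symbols. -/
def CCInput.Le : CCInput → CCInput → Prop
  | .u, _ | .zero, .zero | .zero, .h | .h, .h => True
  | _, _ => False

lemma CCInput.eq_replicate_of_pairwise_le {w : List CCInput} (hw : w.Pairwise CCInput.Le) :
    w = List.replicate (w.count .u) .u ++
      (List.replicate (w.count .zero) .zero ++ List.replicate (w.count .h) .h) := by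
  induction w with
  | nil => rfl
  | cons a w ih =>
    obtain ⟨ha, hw⟩ := List.pairwise_cons.1 hw
    have hn : ∀ b, ¬ CCInput.Le a b → w.count b = 0 := fun b hb =>
      List.count_eq_zero.2 fun hmem => hb (ha b hmem)
    specialize ih hw
    cases a
    · nth_rw 1 [ih]
      simp [List.replicate_succ]
    · have h₁ := hn .u id
      nth_rw 1 [ih]
      simp [List.replicate_succ, h₁]
    · have h₁ := hn .u id
      have h₂ := hn .zero id
      nth_rw 1 [ih]
      simp [List.replicate_succ, h₁, h₂]

/-- Pumping a part `v ++ x ++ y` whose symbols all occur in `x` keeps a word sorted. -/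
lemma List.Pairwise.pump {T : Type*} {R : T → T → Prop} {α v x y β : List T}
    (h : (α ++ (v ++ x ++ y) ++ β).Pairwise R) (hv : v ⊆ x) (hy : y ⊆ x) (i : ℕ) :
    (α ++ ((List.replicate i v).flatten ++ x ++ (List.replicate i y).flatten) ++ β).Pairwise R := by
  have hmem : ∀ (z : List T) a, a ∈ (List.replicate i z).flatten → a ∈ z := by
    intro z a ha
    obtain ⟨z', hz', ha⟩ := List.mem_flatten.1 ha
    rwa [← List.eq_of_mem_replicate hz']
  have hflat : ∀ z : List T, (∀ a ∈ z, ∀ b ∈ z, R a b) →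
      ((List.replicate i z).flatten).Pairwise R := by
    intro z hz
    exact List.pairwise_of_forall_mem_list fun a ha b hb => hz a (hmem z a ha) b (hmem z b hb)
  simp only [List.pairwise_append, List.mem_append] at h ⊢
  obtain ⟨⟨hα, ⟨⟨h1, h2, h3⟩, h4, h5⟩, h6⟩, h7, h8⟩ := h
  -- Letters `a`, `b` of `v` satisfy `R a b` because `b` also occurs in `x`, to the right of `v`;
  -- symmetrically for `y`.
  refine ⟨⟨hα, ⟨⟨hflat v fun a ha b hb => h3 a ha b (hv hb), h2,
    fun a ha b hb => h3 a (hmem v a ha) b hb⟩,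
    hflat y fun a ha b hb => h5 a (.inr (hy ha)) b hb, ?_⟩, ?_⟩, h7, ?_⟩
  · rintro a (ha | ha) b hb
    · exact h5 a (.inl (hmem v a ha)) b (hmem y b hb)
    · exact h5 a (.inr ha) b (hmem y b hb)
  · rintro a ha b ((hb | hb) | hb)
    · exact h6 a ha b (.inl (.inl (hmem v b hb)))
    · exact h6 a ha b (.inl (.inr hb))
    · exact h6 a ha b (.inr (hmem y b hb))
  · rintro a (ha | (ha | ha) | ha) b hb
    · exact h8 a (.inl ha) b hb
    · exact h8 a (.inr (.inl (.inl (hmem v a ha)))) b hb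
    · exact h8 a (.inr (.inl (.inr ha))) b hb
    · exact h8 a (.inr (.inr (hmem y a ha))) b hb

/-- The language of all words over `{u, 0, h}` on which `M_cc` halts is not context-free. -/
theorem mainTheorem1 : ¬ Mcc.language.IsContextFree := by
  intro hL
  obtain ⟨p, hp⟩ := hL.exists_pumping fun w => {a | a ∈ w}
  have hpos := Nat.one_le_two_pow (n := p)
  -- The word attains equality in `2 ^ m ≤ n + 1`.
  obtain ⟨α, v, x, y, β, hw, hne, hx, hpump⟩ := hp
    (List.replicate (2 ^ p - 1) CCInput.u ++ (List.replicate p CCInput.zero ++ [CCInput.h]))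
    ((Mcc.mem_language_iff _ _).2 (by omega)) (by simp; omega)
  have hvx : v ⊆ x := fun a ha => by
    have : a ∈ {a | a ∈ x} := hx ▸ (by simp [ha])
    exact this
  have hyx : y ⊆ x := fun a ha => by
    have : a ∈ {a | a ∈ x} := hx ▸ (by simp [ha])
    exact this
  have hsorted : (α ++ (v ++ x ++ y) ++ β).Pairwise CCInput.Le := by
    rw [← hw]
    simp [List.pairwise_append, List.pairwise_replicate, CCInput.Le]
  have hcount : ∀ a, α.count a + v.count a + x.count a + y.count a + β.count a =
      (List.replicate (2 ^ p - 1) CCInput.u ++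
        (List.replicate p CCInput.zero ++ [CCInput.h])).count a := by
    intro a
    rw [hw]
    simp only [List.count_append]
    omega
  have hu := hcount .u
  have h0 := hcount .zero
  have hh := hcount .h
  simp [List.count_replicate] at hu h0 hh
  -- An `h` in `v` or `y` would force a second one in `x`.
  have hvh : v.count .h = 0 ∧ y.count .h = 0 ∧ α.count .h + x.count .h + β.count .h = 1 := by
    have h₁ : 0 < v.count .h → 0 < x.count .h := fun h =>
      List.count_pos_iff.2 (hvx (List.count_pos_iff.1 h))
    have h₂ : 0 < y.count .h → 0 < x.count .h := fun h =>
      List.count_pos_iff.2 (hyx (List.count_pos_iff.1 h))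
    omega
  have hvy : 0 < v.count .u + y.count .u + v.count .zero + y.count .zero := by
    rcases List.exists_mem_of_ne_nil _ hne with ⟨a, ha⟩
    have := List.count_pos_iff.2 ha
    rw [List.count_append] at this
    cases a <;> omega
  have hpumped : ∀ i, 2 ^ (α.count .zero + x.count .zero + β.count .zero +
      i * (v.count .zero + y.count .zero)) ≤
      α.count .u + x.count .u + β.count .u + i * (v.count .u + y.count .u) + 1 := by
    intro i
    have h := hpump i
    have hc : ∀ a, (α ++ ((List.replicate i v).flatten ++ x ++ (List.replicate i y).flatten) ++
        β).count a = α.count a + x.count a + β.count a + i * (v.count a + y.count a) := by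
      intro a
      simp [List.count_append, List.count_flatten]
      ring
    rw [CCInput.eq_replicate_of_pairwise_le (hsorted.pump hvx hyx i), hc, hc, hc, hvh.1, hvh.2.1,
      hvh.2.2] at h
    exact (Mcc.mem_language_iff _ _).1 h
  have e0 := hpumped 0
  have e2 := hpumped 2
  rcases Nat.eq_zero_or_pos (v.count .zero + y.count .zero) with hz | hz
  -- Only `u`s are pumped: `i = 0` keeps all `p` zeros but has too few `u`s.
  · have : α.count .zero + x.count .zero + β.count .zero +
        0 * (v.count .zero + y.count .zero) = p := by omega
    rw [this] at e0
    omega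
  -- For `i = 2` there are at least `p + 1` zeros, but at most `2 * (2 ^ p - 1)` letters `u`.
  · have : 2 ^ (p + 1) ≤ 2 ^ (α.count .zero + x.count .zero + β.count .zero +
        2 * (v.count .zero + y.count .zero)) := Nat.pow_le_pow_right (by omega) (by omega)
    rw [pow_succ] at this
    omega
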